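/- Let $K$ be a field, $S=K[x_1,\ldots,x_n]$ and let $k$ be a positive integer. A monomial $x_1^{a_1}\cdots x_n^{a_n}$, or a vector $\mathbf a=(a_1,\ldots,a_n)\in\mathbb Z^n$, is called $k$-bounded if $0\le a_i\le k$ for all $i$. Write $\operatorname{supp}(u)=\{i : x_i\mid u\}$ for a monomial $u$. An ideal $I\subseteq S$ generated by $k$-bounded monomials is called $k$-Borel if for every $k$-bounded monomial $u\in I$, every $q\in\operatorname{supp}(u)$ and every $p<q$, one has $x_p(u/x_q)\in I$ whenever $x_p(u/x_q)$ is $k$-bounded. Let $G(I)$ be the minimal set of monomial generators of $I$; for a monomial $u\neq 1$ put $m(u)=\max\operatorname{supp}(u)$ and $u'=u/x_{m(u)}$. Let $\operatorname{Deg}$ denote the $\mathbb Z^n$-degree and put $\mathbf x^F=\prod_{f\in F}x_f$ for $F\subseteq[n]=\{1,\ldots,n\}$. For $1\le j\le n$ let $K_\bullet(x_n,\ldots,x_j;S/I)$ be the Koszul complex, with $S/I$-basis the elements $e_F=e_{f_1}\wedge\cdots\wedge e_{f_i}$ in homological degree $i$, for $F=\{f_1<\cdots<f_i\}\subseteq\{j,\ldots,n\}$,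 with $\partial(e_f)=x_f$, and $\mathbb Z^n$-graded by $\operatorname{Deg}(e_F)=\operatorname{Deg}(\mathbf x^F)$. Let $H_i(x_n,\ldots,x_j;S/I)$ be its homology. **Theorem.** Let $I\subseteq S$ be a $k$-Borel ideal, let $\mathbf a\in\mathbb Z^n$ be $k$-bounded, and let $1\le j\le n$. (a) For every $i>1$, the elements $u'e_F\wedge e_{m(u)}$ with $1\ne u\in G(I)$, $F\subseteq[n]$, $|F|=i-1$, $j\le\min F$, $\max F<m(u)$ and $\operatorname{Deg}(\mathbf x^F u)=\mathbf a$ are cycles, and their homology classes, indexed by the pairs $(u,F)$, form a $K$-basis of the multigraded component $H_i(x_n,\ldots,x_j;S/I)_{\mathbf a}$. (b) The elements $u'e_{m(u)}$ with $1\ne u\in G(I)$, $j\le m(u)$ and $\operatorname{Deg}(u)=\mathbf a$ are cycles, and their homology classes, indexed by $u$, form a $K$-basis of $H_1(x_n,\ldots,x_j;S/I)_{\mathbf a}$. -/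

import Mathlib

noncomputable section

namespace KBorel

open MvPolynomial

variable {K : Type*} [Field K] {n : ℕ}

/-! Monomials of `S = K[x_1, …, x_n]` are written as exponent vectors `u : Fin n →₀ ℕ`; the
monomial itself is `monomial u 1`. The variables are indexed by `Fin n`. -/

/-- A monomial, or a vector, is `k`-bounded if all of its entries are at most `k`. -/
def IsBounded (k : ℕ) (u : Fin n →₀ ℕ) : Prop := ∀ i, u i ≤ k

/-- `k`-Borel ideals: ideals generated by `k`-bounded monomials such that, for every `k`-bounded
monomial `u` in `I`, every `j ∈ supp u` and every `i < j`, the monomial `x_i (u / x_j)` belongs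
to `I` whenever it is `k`-bounded. -/
structure IsKBorel (k : ℕ) (I : Ideal (MvPolynomial (Fin n) K)) : Prop where
  generated : ∃ A : Set (Fin n →₀ ℕ), (∀ u ∈ A, IsBounded k u) ∧
    I = Ideal.span ((fun u => monomial u (1 : K)) '' A)
  borel : ∀ u : Fin n →₀ ℕ, IsBounded k u → monomial u (1 : K) ∈ I →
    ∀ j ∈ u.support, ∀ i < j,
      IsBounded k (u - Finsupp.single j 1 + Finsupp.single i 1) →
        monomial (u - Finsupp.single j 1 + Finsupp.single i 1) (1 : K) ∈ I

/-- `G(I)`, the minimal monomial generators of a monomial ideal `I`: the monomials of `I` that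
are minimal with respect to divisibility. -/
def minGens (I : Ideal (MvPolynomial (Fin n) K)) : Set (Fin n →₀ ℕ) :=
  {u | Minimal (fun v => monomial v (1 : K) ∈ I) u}

/-- The exponent vector of the squarefree monomial `x^F`. -/
def expo (F : Finset (Fin n)) : Fin n →₀ ℕ := ∑ f ∈ F, Finsupp.single f 1

/-- The underlying free `S/I`-module of the Koszul complex `K(x_1, …, x_n; S/I)`, in all
homological degrees together: `z` stands for `∑_F z(F) e_F`, where
`e_F = e_{f_1} ∧ ⋯ ∧ e_{f_r}` for `F = {f_1 < ⋯ < f_r}`. -/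
abbrev Koszul (I : Ideal (MvPolynomial (Fin n) K)) : Type _ :=
  Finset (Fin n) → MvPolynomial (Fin n) K ⧸ I

/-- The element `g e_F` of the Koszul complex, for `g ∈ S`. -/
def mulE (I : Ideal (MvPolynomial (Fin n) K)) (g : MvPolynomial (Fin n) K)
    (F : Finset (Fin n)) : Koszul I :=
  Pi.single F (Ideal.Quotient.mk I g)

/-- The element `g e_F ∧ e_m`. It is zero if `m ∈ F`; otherwise `e_m` is moved to its place, past
the factors `e_f` with `f ∈ F` and `m < f`. -/
def mulEWedge (I : Ideal (MvPolynomial (Fin n) K)) (g : MvPolynomial (Fin n) K)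
    (F : Finset (Fin n)) (m : Fin n) : Koszul I :=
  if m ∈ F then 0 else mulE I ((-1) ^ (F.filter (fun f => m < f)).card * g) (insert m F)

/-- The Koszul differential: `∂(e_F) = ∑_{f ∈ F} (-1)^{#{g ∈ F : g < f}} x_f e_{F \ {f}}`. -/
def koszulD (I : Ideal (MvPolynomial (Fin n) K)) :
    Koszul I →ₗ[MvPolynomial (Fin n) K] Koszul I :=
  ∑ F : Finset (Fin n), ∑ f ∈ F,
    ((-1 : MvPolynomial (Fin n) K) ^ (F.filter (fun g => g < f)).card * X f) •
      (LinearMap.single (MvPolynomial (Fin n) K)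
        (fun _ : Finset (Fin n) => MvPolynomial (Fin n) K ⧸ I) (F.erase f) ∘ₗ LinearMap.proj F)

/-- The chain module `K_i(x_n, …, x_j; S/I)`: the combinations of the `e_F` with `#F = i` and
`F ⊆ {j, …, n}`. -/
def chains (I : Ideal (MvPolynomial (Fin n) K)) (j : Fin n) (i : ℕ) :
    Submodule (MvPolynomial (Fin n) K) (Koszul I) where
  carrier := {z | ∀ F, ¬ (F.card = i ∧ ∀ f ∈ F, j ≤ f) → z F = 0}
  add_mem' hz hw F hF := by simp [hz F hF, hw F hF]
  zero_mem' _ _ := rfl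
  smul_mem' c z hz F hF := by simp [hz F hF]

/-- The cycles in `K_i(x_n, …, x_j; S/I)`. -/
def cycles (I : Ideal (MvPolynomial (Fin n) K)) (j : Fin n) (i : ℕ) :
    Submodule (MvPolynomial (Fin n) K) (Koszul I) :=
  chains I j i ⊓ LinearMap.ker (koszulD I)

/-- The boundaries in `K_i(x_n, …, x_j; S/I)`. -/
def boundaries (I : Ideal (MvPolynomial (Fin n) K)) (j : Fin n) (i : ℕ) :
    Submodule (MvPolynomial (Fin n) K) (Koszul I) :=
  (chains I j (i + 1)).map (koszulD I)

lemma koszulD_single (I : Ideal (MvPolynomial (Fin n) K)) (F : Finset (Fin n))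
    (y : MvPolynomial (Fin n) K ⧸ I) : koszulD I (Pi.single F y) =
      ∑ f ∈ F, ((-1 : MvPolynomial (Fin n) K) ^ (F.filter (fun g => g < f)).card * X f) •
        (Pi.single (F.erase f) y : Koszul I) := by
  unfold koszulD
  rw [LinearMap.sum_apply, Finset.sum_eq_single F]
  · simp [LinearMap.sum_apply]
  · intro G _ hG
    simp [LinearMap.sum_apply, Pi.single_eq_of_ne hG]
  · simp

/-- The formula `∂(g e_F) = ∑_{f ∈ F} (-1)^{#{h ∈ F : h < f}} x_f g e_{F \ {f}}`. -/
lemma koszulD_mulE (I : Ideal (MvPolynomial (Fin n) K)) (g : MvPolynomial (Fin n) K)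
    (F : Finset (Fin n)) : koszulD I (mulE I g F) =
      ∑ f ∈ F, mulE I ((-1) ^ (F.filter (fun h => h < f)).card * X f * g) (F.erase f) := by
  unfold mulE
  rw [koszulD_single]
  refine Finset.sum_congr rfl fun f _ => ?_
  rw [← Pi.single_smul]
  rfl

lemma sign_swap (F : Finset (Fin n)) {f g : Fin n} (hf : f ∈ F) (hfg : f < g) :
    (F.filter (fun h => h < g)).card = ((F.erase f).filter (fun h => h < g)).card + 1 ∧
      (F.filter (fun h => h < f)).card = ((F.erase g).filter (fun h => h < f)).card := by
  constructor
  · rw [Finset.filter_erase, Finset.card_erase_add_one (by simp [hf, hfg])]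
  · rw [Finset.filter_erase, Finset.erase_eq_of_notMem (by simp [hfg.le])]

lemma koszulD_koszulD (I : Ideal (MvPolynomial (Fin n) K)) (z : Koszul I) :
    koszulD I (koszulD I z) = 0 := by
  have key : ∀ F (y : MvPolynomial (Fin n) K ⧸ I),
      koszulD I (koszulD I (Pi.single F y)) = 0 := by
    intro F y
    simp only [koszulD_single, map_sum, map_smul, Finset.smul_sum, smul_smul]
    rw [Finset.sum_sigma']
    refine Finset.sum_involution (fun p _ => ⟨p.2, p.1⟩) ?_ ?_ ?_ ?_
    · rintro ⟨f, g⟩ hp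
      simp only [Finset.mem_sigma, Finset.mem_erase] at hp
      obtain ⟨hf, hne, hg⟩ := hp
      simp only [Finset.erase_right_comm (a := f) (b := g), ← add_smul]
      rcases lt_or_gt_of_ne hne with h | h
      · obtain ⟨h1, h2⟩ := sign_swap F hg h
        rw [h1, h2]
        convert zero_smul (MvPolynomial (Fin n) K) _ using 2
        ring
      · obtain ⟨h1, h2⟩ := sign_swap F hf h
        rw [h1, h2]
        convert zero_smul (MvPolynomial (Fin n) K) _ using 2
        ring
    · rintro ⟨f, g⟩ hp _ h
      simp only [Finset.mem_sigma, Finset.mem_erase] at hp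
      simp only [Sigma.mk.injEq] at h
      exact hp.2.1 h.1
    · rintro ⟨f, g⟩ hp
      simp only [Finset.mem_sigma, Finset.mem_erase] at hp ⊢
      exact ⟨hp.2.2, fun h => hp.2.1 h.symm, hp.1⟩
    · rintro ⟨f, g⟩ _
      rfl
  rw [← Finset.univ_sum_single z]
  simp only [map_sum, key, Finset.sum_const_zero]

lemma boundaries_le_cycles (I : Ideal (MvPolynomial (Fin n) K)) (j : Fin n) (i : ℕ) :
    boundaries I j i ≤ cycles I j i := by
  rintro _ ⟨z, hz, rfl⟩
  refine ⟨fun G hG => ?_, koszulD_koszulD I z⟩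
  rw [← Finset.univ_sum_single z]
  simp only [map_sum, koszulD_single, Finset.sum_apply, Pi.smul_apply]
  refine Finset.sum_eq_zero fun F _ => Finset.sum_eq_zero fun f hf => ?_
  by_cases hG' : G = F.erase f
  · subst hG'
    rw [Pi.single_eq_same, hz F, smul_zero]
    rintro ⟨h1, h2⟩
    refine hG ⟨?_, fun x hx => h2 x (Finset.mem_of_mem_erase hx)⟩
    rw [Finset.card_erase_of_mem hf, h1, Nat.add_sub_cancel]
  · rw [Pi.single_eq_of_ne hG', smul_zero]

/-- The Koszul homology `H_i(x_n, …, x_j; S/I)`, cycles modulo boundaries. -/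
abbrev Homology (I : Ideal (MvPolynomial (Fin n) K)) (j : Fin n) (i : ℕ) : Type _ :=
  cycles I j i ⧸ (boundaries I j i).submoduleOf (cycles I j i)

/-- The homology class `[z]_j` of a cycle `z`. -/
def cls (I : Ideal (MvPolynomial (Fin n) K)) (j : Fin n) (i : ℕ) (z : cycles I j i) :
    Homology I j i :=
  Submodule.Quotient.mk z

/-- The elements of multidegree `a` in the Koszul complex. As `e_F` has the multidegree of
`x^F`, the coefficient of `e_F` has to be a scalar multiple of the class of the monomial
`x^a / x^F`, and has to be zero if `x^F` does not divide `x^a`. -/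
def chainsDeg (I : Ideal (MvPolynomial (Fin n) K)) (a : Fin n →₀ ℕ) : Submodule K (Koszul I) :=
  Submodule.pi Set.univ fun F => Submodule.span K
    {y | ∃ b : Fin n →₀ ℕ, b + expo F = a ∧ y = Ideal.Quotient.mk I (monomial b 1)}

/-- The multigraded component `H_i(x_n, …, x_j; S/I)_a`: the classes of the cycles of
multidegree `a`. -/
def homologyDeg (I : Ideal (MvPolynomial (Fin n) K)) (j : Fin n) (i : ℕ) (a : Fin n →₀ ℕ) :
    Submodule K (Homology I j i) :=
  ((chainsDeg I a).comap ((cycles I j i).subtype.restrictScalars K)).map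
    (((boundaries I j i).submoduleOf (cycles I j i)).mkQ.restrictScalars K)

/-- The triples `(u, F, m)` with `u ∈ G(I)`, `m = m(u)` the greatest element of `supp u`
(so `u ≠ 1`), `#F = i - 1`, `j ≤ min F`, `max F < m(u)` and `Deg(x^F u) = a`. -/
def index (I : Ideal (MvPolynomial (Fin n) K)) (j : Fin n) (i : ℕ) (a : Fin n →₀ ℕ) :
    Set ((Fin n →₀ ℕ) × Finset (Fin n) × Fin n) :=
  {p | p.1 ∈ minGens I ∧ IsGreatest (p.1.support : Set (Fin n)) p.2.2 ∧ p.2.1.card + 1 = i ∧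
    (∀ f ∈ p.2.1, j ≤ f) ∧ (∀ f ∈ p.2.1, f < p.2.2) ∧ expo p.2.1 + p.1 = a}

/-- The pairs `(u, m)` with `u ∈ G(I)`, `m = m(u)` the greatest element of `supp u`
(so `u ≠ 1`), `j ≤ m(u)` and `Deg(u) = a`. -/
def indexOne (I : Ideal (MvPolynomial (Fin n) K)) (j : Fin n) (a : Fin n →₀ ℕ) :
    Set ((Fin n →₀ ℕ) × Fin n) :=
  {p | p.1 ∈ minGens I ∧ IsGreatest (p.1.support : Set (Fin n)) p.2 ∧ j ≤ p.2 ∧ p.1 = a}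

end KBorel

end

noncomputable section

namespace KBorel

open MvPolynomial

variable {K : Type*} [Field K] {n : ℕ}

/-! Both halves rest on one remark: in a triple (u, F, m) of degree a, the index m is q = max
supp(a), so u is determined by F alone.

Independence: lift chains to S and read off the coefficient of x^u e_F in the boundary of the lift
(`coeffD`). This functional kills boundaries because ∂² = 0, and it kills chains with coefficients
in I because u is a minimal generator (`IsKBorel.coeffD_eq_zero`). On the chain of (u, F, m) it is
±1, and on the other chains of degree a it is 0.

Spanning: since a_q ≥ 1, a boundary can be subtracted from a cycle of degree a so that only sets
containing q remain. The coefficient of e_G, q ∉ G, in the boundary of such a cycle comes from the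
single set G ∪ {q}. Hence each surviving term separately satisfies x^{a-G} ∈ I and x^{a-G}/x_q ∉ I,
and the Borel property makes x^{a-G} a minimal generator (`IsKBorel.mem_minGens`). The remaining
cycle is therefore a combination of the proposed chains.

Boundedness of a enters only to license Borel moves. -/

/-! ### Coefficients of the differential and monomial ideals -/

lemma koszulD_apply (I : Ideal (MvPolynomial (Fin n) K)) (z : Koszul I) (G : Finset (Fin n)) :
    koszulD I z G = ∑ f ∈ Gᶜ,
      ((-1 : MvPolynomial (Fin n) K) ^ (G.filter (fun g => g < f)).card * X f) •
        z (insert f G) := by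
  unfold koszulD
  simp only [LinearMap.sum_apply, LinearMap.smul_apply, LinearMap.comp_apply, LinearMap.proj_apply,
    LinearMap.single_apply, Finset.sum_apply, Pi.smul_apply, Pi.single_apply, smul_ite, smul_zero]
  simp only [← Finset.sum_filter]
  -- For fixed G and f, the only F containing f with F \ {f} = G is G ∪ {f}.
  rw [Finset.sum_comm' (t' := Gᶜ) (s' := fun f => {insert f G})]
  · refine Finset.sum_congr rfl fun f _ => ?_
    rw [Finset.sum_singleton, Finset.filter_insert, if_neg (lt_irrefl f)]
  · intro F f
    simp only [Finset.mem_univ, true_and, Finset.mem_filter, Finset.mem_singleton,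
      Finset.mem_compl]
    constructor
    · rintro ⟨h, rfl⟩
      simp [h]
    · rintro ⟨rfl, h⟩
      simp [h]

lemma monomial_mem_of_le {I : Ideal (MvPolynomial (Fin n) K)} {u v : Fin n →₀ ℕ} (h : u ≤ v)
    (hu : monomial u (1 : K) ∈ I) (c : K) : monomial v c ∈ I := by
  have : monomial v c = monomial (v - u) c * monomial u 1 := by
    rw [monomial_mul, tsub_add_cancel_of_le h, mul_one]
  rw [this]
  exact I.mul_mem_left _ hu

lemma IsKBorel.monomial_mem_of_coeff_ne_zero {k : ℕ} {I : Ideal (MvPolynomial (Fin n) K)}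
    (hI : IsKBorel k I) {g : MvPolynomial (Fin n) K} (hg : g ∈ I) {b : Fin n →₀ ℕ}
    (hb : coeff b g ≠ 0) : monomial b (1 : K) ∈ I := by
  obtain ⟨A, -, hA⟩ := hI.generated
  rw [hA, mem_ideal_span_monomial_image] at hg
  obtain ⟨s, hs, hle⟩ := hg b (mem_support_iff.2 hb)
  refine monomial_mem_of_le hle ?_ 1
  rw [hA]
  exact Ideal.subset_span ⟨s, hs, rfl⟩

lemma expo_apply (F : Finset (Fin n)) (i : Fin n) : expo F i = if i ∈ F then 1 else 0 := by
  simp [expo, Finsupp.single_apply]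

lemma expo_insert {F : Finset (Fin n)} {f : Fin n} (hf : f ∉ F) :
    expo (insert f F) = Finsupp.single f 1 + expo F := by
  simp [expo, Finset.sum_insert hf]

/-! ### Lifting chains to S, realised as S/⊥, and the detecting functionals -/

/-- Reduction of chains with coefficients in `S` modulo `I`. -/
def reduce (I : Ideal (MvPolynomial (Fin n) K)) :
    Koszul (⊥ : Ideal (MvPolynomial (Fin n) K)) →ₗ[MvPolynomial (Fin n) K] Koszul I :=
  LinearMap.compLeft (Submodule.factor bot_le) _

lemma reduce_apply_mk (I : Ideal (MvPolynomial (Fin n) K))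
    (z : Koszul (⊥ : Ideal (MvPolynomial (Fin n) K))) (F : Finset (Fin n)) :
    reduce I z F = Ideal.Quotient.mk I (AlgEquiv.quotientBot K _ (z F)) := by
  obtain ⟨g, hg⟩ := Ideal.Quotient.mk_surjective (z F)
  unfold reduce
  rw [LinearMap.compLeft_apply, Function.comp_apply, ← hg]
  rfl

lemma reduce_surjective (I : Ideal (MvPolynomial (Fin n) K)) :
    Function.Surjective (reduce I) := fun z => by
  choose g hg using fun F => Ideal.Quotient.mk_surjective (z F)
  refine ⟨fun F => Ideal.Quotient.mk _ (g F), funext fun F => ?_⟩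
  rw [reduce_apply_mk, ← hg]
  rfl

lemma reduce_koszulD (I : Ideal (MvPolynomial (Fin n) K))
    (z : Koszul (⊥ : Ideal (MvPolynomial (Fin n) K))) :
    reduce I (koszulD ⊥ z) = koszulD I (reduce I z) := by
  funext G
  rw [koszulD_apply]
  unfold reduce
  simp only [LinearMap.compLeft_apply, Function.comp_apply]
  rw [koszulD_apply, map_sum]
  simp only [map_smul]

lemma reduce_mulE (I : Ideal (MvPolynomial (Fin n) K)) (g : MvPolynomial (Fin n) K)
    (F : Finset (Fin n)) : reduce I (mulE ⊥ g F) = mulE I g F := by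
  funext G
  rw [reduce_apply_mk]
  unfold mulE
  rcases eq_or_ne G F with rfl | h
  · rw [Pi.single_eq_same, Pi.single_eq_same]
    rfl
  · rw [Pi.single_eq_of_ne h, Pi.single_eq_of_ne h, map_zero, map_zero]

/-- The coefficient of `x^u e_F` in the boundary of a chain with coefficients in `S`. -/
def coeffD (u : Fin n →₀ ℕ) (F : Finset (Fin n)) :
    Koszul (⊥ : Ideal (MvPolynomial (Fin n) K)) →ₗ[K] K :=
  (lcoeff K u) ∘ₗ (AlgEquiv.quotientBot K (MvPolynomial (Fin n) K)).toLinearMap ∘ₗ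
    LinearMap.proj F ∘ₗ (koszulD ⊥).restrictScalars K

lemma coeffD_apply (u : Fin n →₀ ℕ) (F : Finset (Fin n))
    (z : Koszul (⊥ : Ideal (MvPolynomial (Fin n) K))) :
    coeffD u F z = ∑ f ∈ Fᶜ, (-1) ^ (F.filter (fun g => g < f)).card *
      coeff u (X f * AlgEquiv.quotientBot K (MvPolynomial (Fin n) K) (z (insert f F))) := by
  have h : ∀ (c g : MvPolynomial (Fin n) K) (y : MvPolynomial (Fin n) K ⧸ (⊥ : Ideal _)),
      AlgEquiv.quotientBot K _ ((c * g) • y) = c * (g * AlgEquiv.quotientBot K _ y) := by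
    intro c g y
    obtain ⟨y, rfl⟩ := Ideal.Quotient.mk_surjective y
    rw [← mul_assoc]
    rfl
  change coeff u (AlgEquiv.quotientBot K _ (koszulD ⊥ z F)) = _
  rw [koszulD_apply, map_sum, coeff_sum]
  refine Finset.sum_congr rfl fun f _ => ?_
  rw [h, ← coeff_C_mul, map_pow, map_neg, map_one]

lemma coeffD_koszulD (u : Fin n →₀ ℕ) (F : Finset (Fin n))
    (z : Koszul (⊥ : Ideal (MvPolynomial (Fin n) K))) : coeffD u F (koszulD ⊥ z) = 0 := by
  change lcoeff K u (AlgEquiv.quotientBot K _ (koszulD ⊥ (koszulD ⊥ z) F)) = 0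
  rw [koszulD_koszulD, Pi.zero_apply, map_zero, map_zero]

lemma notMem_of_mem_minGens {I : Ideal (MvPolynomial (Fin n) K)} {u : Fin n →₀ ℕ}
    (hu : u ∈ minGens I) {f : Fin n} (hf : f ∈ u.support) :
    monomial (u - Finsupp.single f 1) (1 : K) ∉ I := fun h => by
  have h1 := hu.2 h tsub_le_self f
  have h2 := Finsupp.mem_support_iff.1 hf
  simp only [Finsupp.tsub_apply, Finsupp.single_eq_same] at h1
  omega

/-- The coefficient of x^u in x_f g is that of x^u/x_f in g. Were it nonzero for some g ∈ I, then
x^u/x_f would lie in I, against minimality of u. -/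
lemma IsKBorel.coeffD_eq_zero {k : ℕ} {I : Ideal (MvPolynomial (Fin n) K)} (hI : IsKBorel k I)
    {u : Fin n →₀ ℕ} (hu : u ∈ minGens I) (F : Finset (Fin n))
    {z : Koszul (⊥ : Ideal (MvPolynomial (Fin n) K))} (hz : reduce I z = 0) :
    coeffD u F z = 0 := by
  rw [coeffD_apply]
  refine Finset.sum_eq_zero fun f _ => ?_
  rw [coeff_X_mul']
  split_ifs with hf
  · by_contra h
    refine notMem_of_mem_minGens hu hf
      (hI.monomial_mem_of_coeff_ne_zero ?_ (right_ne_zero_of_mul h))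
    rw [← Ideal.Quotient.eq_zero_iff_mem, ← reduce_apply_mk, hz, Pi.zero_apply]
  · exact mul_zero _

lemma quotientBot_mulE_self (g : MvPolynomial (Fin n) K) (F : Finset (Fin n)) :
    AlgEquiv.quotientBot K (MvPolynomial (Fin n) K) (mulE ⊥ g F F) = g := by
  unfold mulE
  rw [Pi.single_eq_same]
  rfl

lemma insert_eq_insert_iff {F G : Finset (Fin n)} {f m : Fin n} (hF : m ∉ F) (hG : m ∉ G) :
    insert f F = insert m G ↔ f = m ∧ F = G := by
  constructor
  · intro h
    have h1 : m ∈ insert f F := h ▸ Finset.mem_insert_self m G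
    obtain rfl : f = m := ((Finset.mem_insert.1 h1).resolve_right hF).symm
    exact ⟨rfl, by rw [← Finset.erase_insert hF, h, Finset.erase_insert hG]⟩
  · rintro ⟨rfl, rfl⟩
    rfl

lemma coeffD_mulE_insert_of_ne (u : Fin n →₀ ℕ) {F G : Finset (Fin n)} {m : Fin n}
    (hF : m ∉ F) (hG : m ∉ G) (h : F ≠ G) (g : MvPolynomial (Fin n) K) :
    coeffD u F (mulE ⊥ g (insert m G)) = 0 := by
  rw [coeffD_apply]
  refine Finset.sum_eq_zero fun f _ => ?_
  unfold mulE
  rw [Pi.single_eq_of_ne fun h' => h ((insert_eq_insert_iff hF hG).1 h').2, map_zero, mul_zero,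
    coeff_zero, mul_zero]

lemma coeffD_mulE_insert_self {u : Fin n →₀ ℕ} {F : Finset (Fin n)} {m : Fin n}
    (hF : m ∉ F) (hu : m ∈ u.support) :
    coeffD u F (mulE ⊥ (monomial (u - Finsupp.single m 1) (1 : K)) (insert m F)) ≠ 0 := by
  rw [coeffD_apply, Finset.sum_eq_single m]
  · rw [quotientBot_mulE_self, coeff_X_mul', if_pos hu, coeff_monomial, if_pos rfl, mul_one]
    exact pow_ne_zero _ (neg_ne_zero.2 one_ne_zero)
  · intro f _ hf
    unfold mulE
    rw [Pi.single_eq_of_ne fun h' => hf ((insert_eq_insert_iff hF hF).1 h').1, map_zero, mul_zero,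
      coeff_zero, mul_zero]
  · intro h
    exact absurd (Finset.mem_compl.2 hF) h

lemma mulEWedge_eq_mulE (I : Ideal (MvPolynomial (Fin n) K)) (g : MvPolynomial (Fin n) K)
    {F : Finset (Fin n)} {m : Fin n} (h : ∀ f ∈ F, f < m) :
    mulEWedge I g F m = mulE I g (insert m F) := by
  unfold mulEWedge
  rw [if_neg fun hm => lt_irrefl _ (h m hm),
    Finset.filter_false_of_mem fun f hf => (h f hf).le.not_gt, Finset.card_empty, pow_zero, one_mul]

lemma isGreatest_support_add {u : Fin n →₀ ℕ} {F : Finset (Fin n)} {m : Fin n}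
    (hu : IsGreatest (u.support : Set (Fin n)) m) (hF : ∀ f ∈ F, f < m) :
    IsGreatest ((expo F + u).support : Set (Fin n)) m := by
  constructor
  · have := hu.1
    simp only [SetLike.mem_coe, Finsupp.mem_support_iff, Finsupp.add_apply] at this ⊢
    omega
  · intro f hf
    simp only [SetLike.mem_coe, Finsupp.mem_support_iff, Finsupp.add_apply, expo_apply] at hf
    by_cases h : f ∈ F
    · exact (hF f h).le
    · rw [if_neg h, zero_add] at hf
      exact hu.2 (Finsupp.mem_support_iff.2 hf)

/-! ### The basis chains: independence modulo boundaries, and the cycle condition -/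

/-- The chain `u' e_F ∧ e_m` attached to a triple `(u, F, m)`, where `u' = u / x_m`. -/
def basisChain (I : Ideal (MvPolynomial (Fin n) K))
    (p : (Fin n →₀ ℕ) × Finset (Fin n) × Fin n) : Koszul I :=
  mulE I (monomial (p.1 - Finsupp.single p.2.2 1) 1) (insert p.2.2 p.2.1)

/-- The functional `coeffD` at (u, F) isolates the coefficient of the triple (u, F, m). The chain y
is arbitrary, so independence holds even modulo boundaries from the full Koszul complex. -/
lemma IsKBorel.basisChain_independent {k : ℕ} {I : Ideal (MvPolynomial (Fin n) K)}
    (hI : IsKBorel k I) {j : Fin n} {i : ℕ} {a : Fin n →₀ ℕ} {ι : Type*}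
    {g : ι → (Fin n →₀ ℕ) × Finset (Fin n) × Fin n} (hg : Function.Injective g)
    (hgi : ∀ p, g p ∈ index I j i a) (s : Finset ι) (c : ι → K) (y : Koszul I)
    (h : ∑ p ∈ s, c p • basisChain I (g p) = koszulD I y) : ∀ p ∈ s, c p = 0 := by
  intro p hps
  obtain ⟨y, rfl⟩ := reduce_surjective I y
  obtain ⟨hu, hm, -, -, hF, ha⟩ := hgi p
  have hmF : (g p).2.2 ∉ (g p).2.1 := fun h => lt_irrefl _ (hF _ h)
  have h0 : reduce I (∑ p ∈ s, c p • basisChain ⊥ (g p) - koszulD ⊥ y) = 0 := by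
    rw [map_sub, reduce_koszulD, ← h, map_sum, sub_eq_zero]
    refine Finset.sum_congr rfl fun q _ => ?_
    rw [LinearMap.map_smul_of_tower]
    exact congrArg _ (reduce_mulE _ _ _)
  have h1 := hI.coeffD_eq_zero hu (g p).2.1 h0
  rw [map_sub, coeffD_koszulD, sub_zero, map_sum, Finset.sum_eq_single p] at h1
  · rw [map_smul, smul_eq_mul] at h1
    exact (mul_eq_zero.1 h1).resolve_right (coeffD_mulE_insert_self hmF hm.1)
  · intro q _ hne
    obtain ⟨-, hl, -, -, hG, ha'⟩ := hgi q
    -- Both are the greatest element of supp(a), so distinct triples must differ in F.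
    have hml : (g p).2.2 = (g q).2.2 :=
      (ha ▸ isGreatest_support_add hm hF).unique (ha' ▸ isGreatest_support_add hl hG)
    have hqG : (g p).2.2 ∉ (g q).2.1 := fun h => (hml ▸ hG _ h).ne rfl
    rw [map_smul]
    refine smul_eq_zero_of_right _ ?_
    unfold basisChain
    rw [← hml]
    refine coeffD_mulE_insert_of_ne _ hmF hqG (fun hFG => hne (hg ?_)) _
    rw [← ha', ← hFG] at ha
    exact Prod.ext (add_left_cancel ha).symm (Prod.ext hFG.symm hml.symm)
  · exact fun h => absurd hps h

/-- Every coefficient of the boundary is ± x_f u' with f = m or f ∈ F: it is u itself, or a Borel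
move of u. The condition j ≤ m is separate because an empty F does not force it. -/
lemma IsKBorel.basisChain_mem_cycles {k : ℕ} {I : Ideal (MvPolynomial (Fin n) K)}
    (hI : IsKBorel k I) {j : Fin n} {i : ℕ} {a : Fin n →₀ ℕ} (ha : IsBounded k a)
    {p : (Fin n →₀ ℕ) × Finset (Fin n) × Fin n} (hp : p ∈ index I j i a) (hj : j ≤ p.2.2) :
    basisChain I p ∈ cycles I j i := by
  obtain ⟨u, F, m⟩ := p
  obtain ⟨hu, hm, hc, hjF, hF, rfl⟩ := hp
  dsimp only at *
  have hmF : m ∉ F := fun h => lt_irrefl _ (hF m h)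
  constructor
  · intro G hG
    refine Pi.single_eq_of_ne ?_ _
    rintro rfl
    refine hG ⟨by rw [Finset.card_insert_of_notMem hmF, hc], fun f hf => ?_⟩
    rcases Finset.mem_insert.1 hf with rfl | hf
    exacts [hj, hjF f hf]
  · change koszulD I _ = 0
    unfold basisChain
    rw [koszulD_mulE]
    refine Finset.sum_eq_zero fun f hf => ?_
    have hmem : X f * monomial (u - Finsupp.single m 1) (1 : K) ∈ I := by
      rw [X, monomial_mul, one_mul, add_comm]
      rcases Finset.mem_insert.1 hf with rfl | hf
      · rw [tsub_add_cancel_of_le]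
        · exact hu.1
        · rw [Finsupp.single_le_iff]
          exact Nat.one_le_iff_ne_zero.2 (Finsupp.mem_support_iff.1 hm.1)
      -- Both u and x_f u/x_m divide x^F u = x^a, hence are k-bounded.
      · refine hI.borel u (fun l => le_trans ?_ (ha l)) hu.1 m hm.1 f (hF f hf)
          fun l => le_trans ?_ (ha l)
        · exact Nat.le_add_left _ _
        · simp only [Finsupp.add_apply, Finsupp.tsub_apply, expo_apply, Finsupp.single_apply]
          split_ifs <;> first | omega | (subst_vars; contradiction)
    unfold mulE
    rw [mul_assoc, Ideal.Quotient.eq_zero_iff_mem.2 (I.mul_mem_left _ hmem), Pi.single_zero]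

/-! ### Chains of a fixed multidegree -/

/-- The scalar is normalised to 0 when y = 0 or x^F does not divide x^a. A nonzero scalar thus
certifies that a - F is a true difference and that y ≠ 0. -/
lemma mem_span_monomial_iff {I : Ideal (MvPolynomial (Fin n) K)} {a : Fin n →₀ ℕ}
    {F : Finset (Fin n)} {y : MvPolynomial (Fin n) K ⧸ I} :
    y ∈ Submodule.span K {y | ∃ b : Fin n →₀ ℕ, b + expo F = a ∧
        y = Ideal.Quotient.mk I (monomial b 1)} ↔
      ∃ c : K, (c ≠ 0 → expo F ≤ a ∧ y ≠ 0) ∧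
        y = Ideal.Quotient.mk I (monomial (a - expo F) c) := by
  have hmon : ∀ c : K, c • Ideal.Quotient.mk I (monomial (a - expo F) 1) =
      Ideal.Quotient.mk I (monomial (a - expo F) c) := fun c => by
    rw [← Ideal.Quotient.mkₐ_eq_mk K, ← map_smul, smul_monomial, smul_eq_mul, mul_one]
  by_cases hF : expo F ≤ a
  · have hset : {y | ∃ b : Fin n →₀ ℕ, b + expo F = a ∧
        y = Ideal.Quotient.mk I (monomial b (1 : K))} =
        {Ideal.Quotient.mk I (monomial (a - expo F) 1)} := by
      ext y
      constructor
      · rintro ⟨b, rfl, rfl⟩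
        rw [add_tsub_cancel_right]
        rfl
      · rintro rfl
        exact ⟨_, tsub_add_cancel_of_le hF, rfl⟩
    rw [hset, Submodule.mem_span_singleton]
    constructor
    · rintro ⟨c, rfl⟩
      by_cases h : c • Ideal.Quotient.mk I (monomial (a - expo F) (1 : K)) = 0
      · exact ⟨0, fun h => absurd rfl h, by rw [h, map_zero, map_zero]⟩
      · exact ⟨c, fun _ => ⟨hF, h⟩, hmon c⟩
    · rintro ⟨c, -, rfl⟩
      exact ⟨c, hmon c⟩
  · have hset : {y | ∃ b : Fin n →₀ ℕ, b + expo F = a ∧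
        y = Ideal.Quotient.mk I (monomial b (1 : K))} = ∅ := by
      refine Set.eq_empty_of_forall_notMem ?_
      rintro y ⟨b, rfl, -⟩
      exact hF le_add_self
    rw [hset, Submodule.span_empty, Submodule.mem_bot]
    constructor
    · rintro rfl
      exact ⟨0, fun h => absurd rfl h, by rw [map_zero, map_zero]⟩
    · rintro ⟨c, hc, rfl⟩
      by_contra h
      exact hF (hc fun h' => h (by rw [h', map_zero, map_zero])).1

lemma mem_chainsDeg_iff {I : Ideal (MvPolynomial (Fin n) K)} {a : Fin n →₀ ℕ} {z : Koszul I} :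
    z ∈ chainsDeg I a ↔ ∀ F, ∃ c : K, (c ≠ 0 → expo F ≤ a ∧ z F ≠ 0) ∧
      z F = Ideal.Quotient.mk I (monomial (a - expo F) c) := by
  unfold chainsDeg
  rw [Submodule.mem_pi]
  simp only [Set.mem_univ, forall_true_left, mem_span_monomial_iff]

lemma expo_le_of_insert_le {a : Fin n →₀ ℕ} {F : Finset (Fin n)} {f : Fin n}
    (h : expo (insert f F) ≤ a) : expo F ≤ a := by
  refine le_trans (fun l => ?_) h
  simp only [expo_apply, Finset.mem_insert]
  split_ifs <;> first | omega | tauto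

/-- Multiplication by `x_f` sends the class of `x^{a - F - f}` to that of `x^{a - F}`. -/
lemma smul_mk_monomial (I : Ideal (MvPolynomial (Fin n) K)) {a : Fin n →₀ ℕ}
    {F : Finset (Fin n)} {f : Fin n} (hf : f ∉ F) (h : expo (insert f F) ≤ a) (s : ℕ) (c : K) :
    ((-1 : MvPolynomial (Fin n) K) ^ s * X f) •
        Ideal.Quotient.mk I (monomial (a - expo (insert f F)) c) =
      Ideal.Quotient.mk I (monomial (a - expo F) ((-1) ^ s * c)) := by
  have : a - expo F = Finsupp.single f 1 + (a - expo (insert f F)) := by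
    rw [expo_insert hf] at h ⊢
    ext l
    have := h l
    simp only [Finsupp.add_apply, Finsupp.tsub_apply] at this ⊢
    omega
  change Ideal.Quotient.mk I (((-1) ^ s * X f) * _) = _
  rw [mul_assoc, X, monomial_mul, one_mul, ← this, ← C_mul_monomial, map_pow, map_neg, map_one]

lemma koszulD_mem_chainsDeg {I : Ideal (MvPolynomial (Fin n) K)} {a : Fin n →₀ ℕ} {z : Koszul I}
    (hz : z ∈ chainsDeg I a) : koszulD I z ∈ chainsDeg I a := by
  unfold chainsDeg
  rw [Submodule.mem_pi]
  intro G _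
  rw [koszulD_apply]
  refine Submodule.sum_mem _ fun f hf => ?_
  obtain ⟨c, hc, h⟩ := mem_chainsDeg_iff.1 hz (insert f G)
  rw [h]
  by_cases hc0 : c = 0
  · rw [hc0, map_zero, map_zero, smul_zero]
    exact zero_mem _
  · have hle := (hc hc0).1
    rw [smul_mk_monomial I (Finset.mem_compl.1 hf) hle]
    have hmem := Submodule.smul_mem _ ((-1) ^ (G.filter (fun g => g < f)).card * c)
      (Submodule.subset_span (R := K) (s := {y | ∃ b : Fin n →₀ ℕ, b + expo G = a ∧
        y = Ideal.Quotient.mk I (monomial b (1 : K))})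
        ⟨_, tsub_add_cancel_of_le (expo_le_of_insert_le hle), rfl⟩)
    rwa [← Ideal.Quotient.mkₐ_eq_mk K, ← map_smul, smul_monomial, smul_eq_mul, mul_one] at hmem

/-! ### Spanning -/

/-- If u were not minimal, some u/x_l would lie in I. Either l = q, or l < q and replacing x_q by
x_l in u/x_l gives u/x_q ∈ I; both are excluded. -/
lemma IsKBorel.mem_minGens {k : ℕ} {I : Ideal (MvPolynomial (Fin n) K)} (hI : IsKBorel k I)
    {u : Fin n →₀ ℕ} (hb : IsBounded k u) (hu : monomial u (1 : K) ∈ I) {q : Fin n}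
    (hq : IsGreatest (u.support : Set (Fin n)) q)
    (hn : monomial (u - Finsupp.single q 1) (1 : K) ∉ I) : u ∈ minGens I := by
  refine ⟨hu, fun v hv hvu => ?_⟩
  by_contra hlt
  obtain ⟨l, hl⟩ : ∃ l, v l < u l := by
    by_contra! h
    exact hlt h
  have hvl : v ≤ u - Finsupp.single l 1 := fun t => by
    have := hvu t
    simp only [Finsupp.tsub_apply, Finsupp.single_apply]
    split_ifs with h
    · subst h
      omega
    · omega
  have hmem : monomial (u - Finsupp.single l 1) (1 : K) ∈ I := monomial_mem_of_le hvl hv 1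
  have hlu : l ∈ u.support := Finsupp.mem_support_iff.2 (by omega)
  rcases eq_or_ne l q with rfl | hlq
  · exact hn hmem
  have hq0 : u q ≠ 0 := Finsupp.mem_support_iff.1 hq.1
  have heq : u - Finsupp.single l 1 - Finsupp.single q 1 + Finsupp.single l 1 =
      u - Finsupp.single q 1 := by
    ext t
    simp only [Finsupp.add_apply, Finsupp.tsub_apply, Finsupp.single_apply]
    split_ifs <;> first | omega | (subst_vars; omega)
  have hsub : ∀ t, IsBounded k (u - Finsupp.single t 1) := fun t s =>
    le_trans (Nat.sub_le _ _) (hb s)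
  have := hI.borel _ (hsub l) hmem q
    (Finsupp.mem_support_iff.2 (by
      rwa [Finsupp.tsub_apply, Finsupp.single_eq_of_ne hlq.symm, Nat.sub_zero]))
    l (lt_of_le_of_ne (hq.2 hlu) hlq)
  rw [heq] at this
  exact hn (this (hsub q))

/-- A cycle of degree `a` supported on the sets containing the greatest element of `supp a` is a
combination of the chains `u' e_F ∧ e_{m(u)}`. -/
lemma IsKBorel.mem_span_basisChain {k : ℕ} {I : Ideal (MvPolynomial (Fin n) K)}
    (hI : IsKBorel k I) {j : Fin n} {i : ℕ} {a : Fin n →₀ ℕ} (ha : IsBounded k a) {q : Fin n}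
    (hq : IsGreatest (a.support : Set (Fin n)) q) {z : Koszul I} (hz : z ∈ cycles I j i)
    (hza : z ∈ chainsDeg I a) (hzq : ∀ F, q ∉ F → z F = 0) :
    z ∈ Submodule.span K (basisChain I '' {p ∈ index I j i a | j ≤ p.2.2}) := by
  rw [← Finset.univ_sum_single z]
  refine Submodule.sum_mem _ fun F _ => ?_
  by_cases hF0 : z F = 0
  · rw [hF0, Pi.single_zero]
    exact zero_mem _
  have hqF : q ∈ F := by
    by_contra h
    exact hF0 (hzq F h)
  obtain ⟨G, hqG, rfl⟩ : ∃ G, q ∉ G ∧ insert q G = F :=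
    ⟨F.erase q, Finset.notMem_erase q F, Finset.insert_erase hqF⟩
  obtain ⟨hcard, hjF⟩ : (insert q G).card = i ∧ ∀ f ∈ insert q G, j ≤ f := by
    by_contra h
    exact hF0 (hz.1 _ h)
  obtain ⟨c, hc, hzF⟩ := mem_chainsDeg_iff.1 hza (insert q G)
  have hc0 : c ≠ 0 := by
    rintro rfl
    exact hF0 (by rw [hzF, map_zero, map_zero])
  have hle := (hc hc0).1
  have hGle := expo_le_of_insert_le hle
  have hD : koszulD I z G = 0 := congrFun hz.2 G
  -- For f ≠ q the set G ∪ {f} misses q, so only f = q contributes to the coefficient of e_G.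
  rw [koszulD_apply, Finset.sum_eq_single q, hzF, smul_mk_monomial I hqG hle,
    Ideal.Quotient.eq_zero_iff_mem] at hD
  rotate_left
  · intro f _ hf
    rw [hzq _ (by simp [hf.symm, hqG]), smul_zero]
  · intro h
    exact absurd (Finset.mem_compl.2 hqG) h
  have hu := hI.monomial_mem_of_coeff_ne_zero hD (b := a - expo G) (by
    rw [coeff_monomial, if_pos rfl]
    exact mul_ne_zero (pow_ne_zero _ (neg_ne_zero.2 one_ne_zero)) hc0)
  have hsub : a - expo (insert q G) = a - expo G - Finsupp.single q 1 := by
    rw [expo_insert hqG, add_comm, tsub_add_eq_tsub_tsub]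
  have hn : monomial (a - expo G - Finsupp.single q 1) (1 : K) ∉ I := fun h => by
    refine hF0 ?_
    rw [hzF, hsub, Ideal.Quotient.eq_zero_iff_mem]
    exact monomial_mem_of_le le_rfl h c
  have hgr : IsGreatest ((a - expo G).support : Set (Fin n)) q := by
    constructor
    · have := Finsupp.mem_support_iff.1 hq.1
      simpa [expo_apply, hqG] using this
    · intro f hf
      refine hq.2 ?_
      simp only [SetLike.mem_coe, Finsupp.mem_support_iff, Finsupp.tsub_apply] at hf ⊢
      omega
  have hmem : (a - expo G, G, q) ∈ {p ∈ index I j i a | j ≤ p.2.2} := by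
    refine ⟨⟨hI.mem_minGens (fun l => le_trans (Nat.sub_le _ _) (ha l)) hu hgr hn, hgr, ?_,
      fun f hf => hjF f (Finset.mem_insert_of_mem hf), fun f hf => ?_, ?_⟩,
      hjF q (Finset.mem_insert_self q G)⟩
    · rw [← hcard, Finset.card_insert_of_notMem hqG]
    · refine lt_of_le_of_ne (hq.2 ?_) fun h : f = q => hqG (h ▸ hf)
      have := hGle f
      rw [expo_apply, if_pos hf] at this
      exact Finsupp.mem_support_iff.2 (by omega)
    · exact add_tsub_cancel_of_le hGle
  have heq : Pi.single (insert q G) (z (insert q G)) = c • basisChain I (a - expo G, G, q) := by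
    unfold basisChain mulE
    dsimp only
    rw [← Pi.single_smul, hzF, hsub, ← Ideal.Quotient.mkₐ_eq_mk K, ← map_smul, smul_monomial,
      smul_eq_mul, mul_one]
  rw [heq]
  exact Submodule.smul_mem _ _ (Submodule.subset_span (Set.mem_image_of_mem _ hmem))

/-- Within degree a, a term whose set F misses q has coefficient divisible by x_q. Dividing by x_q
and wedging with e_q gives a chain whose boundary cancels all such terms. -/
lemma IsKBorel.exists_sub_boundary_mem_span {k : ℕ} {I : Ideal (MvPolynomial (Fin n) K)}
    (hI : IsKBorel k I) {j : Fin n} {i : ℕ} (hi : 0 < i) {a : Fin n →₀ ℕ} (ha : IsBounded k a)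
    {z : Koszul I} (hz : z ∈ cycles I j i) (hza : z ∈ chainsDeg I a) :
    ∃ y ∈ chains I j (i + 1), z - koszulD I y ∈
      Submodule.span K (basisChain I '' {p ∈ index I j i a | j ≤ p.2.2}) := by
  by_cases hz0 : z = 0
  · exact ⟨0, zero_mem _, by rw [hz0, map_zero, sub_zero]; exact zero_mem _⟩
  choose c hc hcz using mem_chainsDeg_iff.1 hza
  have hch : ∀ F, z F ≠ 0 → F.card = i ∧ ∀ f ∈ F, j ≤ f := fun F hF => by
    by_contra h
    exact hF (hz.1 _ h)
  -- As i > 0, a nonzero coefficient of z sits at a nonempty F ⊆ supp(a) with j ≤ min F.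
  obtain ⟨q, hq, hjq⟩ : ∃ q, IsGreatest (a.support : Set (Fin n)) q ∧ j ≤ q := by
    obtain ⟨F, hF⟩ := Function.ne_iff.1 hz0
    have hcF : c F ≠ 0 := by
      intro h
      exact hF (by rw [hcz, h, map_zero, map_zero]; rfl)
    obtain ⟨hcard, hjF⟩ := hch F hF
    obtain ⟨f, hf⟩ := Finset.card_pos.1 (hcard ▸ hi)
    have hfa : f ∈ a.support := by
      have := (hc F hcF).1 f
      rw [expo_apply, if_pos hf] at this
      exact Finsupp.mem_support_iff.2 (by omega)
    have hgr := a.support.isGreatest_max' ⟨f, hfa⟩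
    exact ⟨_, hgr, (hjF f hf).trans (hgr.2 hfa)⟩
  have hins : ∀ F, q ∉ F → expo F ≤ a → expo (insert q F) ≤ a := fun F hqF hF l => by
    have h1 := Finsupp.mem_support_iff.1 hq.1
    have h2 := hF l
    simp only [expo_apply, Finset.mem_insert] at h2 ⊢
    rcases eq_or_ne l q with rfl | h
    · simp only [true_or, if_true]
      omega
    · simpa only [h, false_or] using h2
  -- The sign is that of x_q e_{G \ {q}} in the boundary of e_G, so it squares to 1 in ∂y.
  let y : Koszul I := fun G => if q ∈ G then
    ((-1 : MvPolynomial (Fin n) K) ^ ((G.erase q).filter (fun g => g < q)).card) •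
      Ideal.Quotient.mk I (monomial (a - expo G) (c (G.erase q))) else 0
  have hyc : ∀ G, q ∉ G → y (insert q G) =
      Ideal.Quotient.mk I (monomial (a - expo (insert q G))
        ((-1) ^ (G.filter (fun g => g < q)).card * c G)) := fun G hG => by
    simp only [y]
    rw [if_pos (Finset.mem_insert_self q G), Finset.erase_insert hG, ← C_mul_monomial, map_pow,
      map_neg, map_one]
    rfl
  have hy0 : ∀ G, q ∉ G → y G = 0 := fun G hG => if_neg hG
  have hyne : ∀ G, q ∉ G → y (insert q G) ≠ 0 → c G ≠ 0 := fun G hG h h' => by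
    rw [hyc G hG, h', mul_zero, map_zero, map_zero] at h
    exact h rfl
  have hychains : y ∈ chains I j (i + 1) := by
    intro F hF
    by_cases hqF : q ∈ F
    · rw [← Finset.insert_erase hqF]
      by_contra h
      have hqG := Finset.notMem_erase q F
      obtain ⟨hcard, hjG⟩ := hch _ (hc _ (hyne _ hqG h)).2
      refine hF ⟨?_, fun f hf => ?_⟩
      · rw [← hcard, Finset.card_erase_add_one hqF]
      · rcases eq_or_ne f q with rfl | hne
        exacts [hjq, hjG f (Finset.mem_erase.2 ⟨hne, hf⟩)]
    · exact hy0 F hqF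
  have hydeg : y ∈ chainsDeg I a := by
    refine mem_chainsDeg_iff.2 fun F => ?_
    by_cases h0 : y F = 0
    · exact ⟨0, fun h => absurd rfl h, by rw [h0, map_zero, map_zero]⟩
    have hqF : q ∈ F := by
      by_contra h
      exact h0 (hy0 F h)
    rw [← Finset.insert_erase hqF] at h0 ⊢
    have hqG := Finset.notMem_erase q F
    exact ⟨_, fun _ => ⟨hins _ hqG (hc _ (hyne _ hqG h0)).1, h0⟩, hyc _ hqG⟩
  refine ⟨y, hychains, hI.mem_span_basisChain ha hq
    (sub_mem hz (boundaries_le_cycles I j i ⟨y, hychains, rfl⟩))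
    (sub_mem hza (koszulD_mem_chainsDeg hydeg)) fun F hqF => ?_⟩
  rw [Pi.sub_apply, sub_eq_zero, koszulD_apply, Finset.sum_eq_single q, hyc F hqF, hcz F]
  · by_cases h0 : c F = 0
    · rw [h0, mul_zero, map_zero, map_zero, map_zero, map_zero, smul_zero]
    · rw [smul_mk_monomial I hqF (hins F hqF (hc F h0).1), ← mul_assoc, ← mul_pow, neg_one_mul,
        neg_neg, one_pow, one_mul]
  · intro f _ hf
    rw [hy0 _ (by simp [hf.symm, hqF]), smul_zero]
  · intro h
    exact absurd (Finset.mem_compl.2 hqF) h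

/-! ### Passage to homology and assembly of the basis -/

lemma basisChain_mem_chainsDeg {I : Ideal (MvPolynomial (Fin n) K)} {j : Fin n} {i : ℕ}
    {a : Fin n →₀ ℕ} {p : (Fin n →₀ ℕ) × Finset (Fin n) × Fin n} (hp : p ∈ index I j i a) :
    basisChain I p ∈ chainsDeg I a := by
  obtain ⟨u, F, m⟩ := p
  obtain ⟨-, hm, -, -, hF, ha⟩ := hp
  dsimp only at hm hF ha
  unfold chainsDeg
  rw [Submodule.mem_pi]
  intro G _
  unfold basisChain mulE
  dsimp only
  by_cases hG : G = insert m F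
  · subst hG
    rw [Pi.single_eq_same]
    refine Submodule.subset_span ⟨_, ?_, rfl⟩
    rw [expo_insert fun h => lt_irrefl _ (hF m h), ← add_assoc, tsub_add_cancel_of_le, add_comm, ha]
    rw [Finsupp.single_le_iff]
    exact Nat.one_le_iff_ne_zero.2 (Finsupp.mem_support_iff.1 hm.1)
  · rw [Pi.single_eq_of_ne hG]
    exact zero_mem _

/-- In positive homological degree, the classes of the chains `u' e_F ∧ e_{m(u)}` form a basis of
the component of `k`-bounded multidegree `a` of the Koszul homology. -/
theorem IsKBorel.exists_basis {k : ℕ} {I : Ideal (MvPolynomial (Fin n) K)} (hI : IsKBorel k I)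
    {a : Fin n →₀ ℕ} (ha : IsBounded k a) (j : Fin n) {i : ℕ} (hi : 0 < i) :
    ∃ b : Module.Basis {p ∈ index I j i a | j ≤ p.2.2} K (homologyDeg I j i a),
      ∀ p : {p ∈ index I j i a | j ≤ p.2.2}, ∃ hz : basisChain I p ∈ cycles I j i,
        (b p : Homology I j i) = cls I j i ⟨_, hz⟩ := by
  have hcyc : ∀ p : {p ∈ index I j i a | j ≤ p.2.2}, basisChain I p ∈ cycles I j i := fun p =>
    hI.basisChain_mem_cycles ha p.2.1 p.2.2
  let w : {p ∈ index I j i a | j ≤ p.2.2} → cycles I j i := fun p => ⟨_, hcyc p⟩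
  let π : cycles I j i →ₗ[K] Homology I j i :=
    ((boundaries I j i).submoduleOf (cycles I j i)).mkQ.restrictScalars K
  let v : {p ∈ index I j i a | j ≤ p.2.2} → homologyDeg I j i a := fun p =>
    ⟨π (w p), Submodule.mem_map_of_mem (basisChain_mem_chainsDeg p.2.1)⟩
  have hli : LinearIndependent K v := by
    refine LinearIndependent.of_comp (homologyDeg I j i a).subtype ?_
    rw [linearIndependent_iff']
    intro s c hs
    have hs' : π (∑ p ∈ s, c p • w p) = 0 := by
      rw [map_sum, ← hs]
      exact Finset.sum_congr rfl fun p _ => map_smul π _ _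
    obtain ⟨y, -, hy⟩ := (Submodule.Quotient.mk_eq_zero _).1 hs'
    refine hI.basisChain_independent Subtype.val_injective (fun p => p.2.1) s c y ?_
    rw [hy]
    change _ = (cycles I j i).subtype.restrictScalars K (∑ p ∈ s, c p • w p)
    rw [map_sum]
    exact Finset.sum_congr rfl fun p _ => rfl
  have hspan : ⊤ ≤ Submodule.span K (Set.range v) := by
    rintro ⟨_, z, hz, rfl⟩ -
    obtain ⟨y, hy, hzy⟩ := hI.exists_sub_boundary_mem_span hi ha z.2 hz
    -- The span was found among all chains; it is carried back to the submodule of cycles, where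
    -- classes are defined.
    have key : ∀ x ∈ Submodule.span K (basisChain I '' {p ∈ index I j i a | j ≤ p.2.2}),
        ∃ x' ∈ Submodule.span K (Set.range w), (x' : Koszul I) = x := by
      intro x hx
      have : basisChain I '' {p ∈ index I j i a | j ≤ p.2.2} =
          (cycles I j i).subtype.restrictScalars K '' Set.range w := by
        rw [← Set.range_comp, Set.image_eq_range]
        rfl
      rw [this, Submodule.span_image] at hx
      exact hx
    obtain ⟨x, hx, hxz⟩ := key _ hzy
    have hπ : π x = π z := by
      refine (Submodule.Quotient.eq _).2 ?_
      change (x : Koszul I) - z ∈ boundaries I j i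
      rw [hxz, sub_sub_cancel_left]
      exact neg_mem ⟨y, hy, rfl⟩
    have hmem : π x ∈ (Submodule.span K (Set.range v)).map (homologyDeg I j i a).subtype := by
      rw [← Submodule.span_image, ← Set.range_comp]
      have := Submodule.mem_map_of_mem (f := π) hx
      rwa [← Submodule.span_image, ← Set.range_comp] at this
    obtain ⟨x', hx', hxx⟩ := hmem
    have hx : x' = ⟨π z, Submodule.mem_map_of_mem hz⟩ := Subtype.ext (hxx.trans hπ)
    rwa [hx] at hx'
  exact ⟨Module.Basis.mk hli hspan, fun p => ⟨hcyc p, by rw [Module.Basis.mk_apply]; rfl⟩⟩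

end KBorel

end

theorem theorem2p1 {K : Type*} [Field K] {n k : ℕ} (hk : 0 < k)
    (I : Ideal (MvPolynomial (Fin n) K)) (hI : KBorel.IsKBorel k I)
    (a : Fin n →₀ ℕ) (ha : KBorel.IsBounded k a) (j : Fin n) :
    (∀ i : ℕ, 1 < i →
      ∃ b : Module.Basis (KBorel.index I j i a) K (KBorel.homologyDeg I j i a),
        ∀ (u : Fin n →₀ ℕ) (F : Finset (Fin n)) (m : Fin n)
          (hp : (u, F, m) ∈ KBorel.index I j i a),
          ∃ hz : KBorel.mulEWedge I (MvPolynomial.monomial (u - Finsupp.single m 1) 1) F m ∈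
              KBorel.cycles I j i,
            (b ⟨(u, F, m), hp⟩ : KBorel.Homology I j i) = KBorel.cls I j i ⟨_, hz⟩) ∧
    (∃ b : Module.Basis (KBorel.indexOne I j a) K (KBorel.homologyDeg I j 1 a),
      ∀ (u : Fin n →₀ ℕ) (m : Fin n) (hp : (u, m) ∈ KBorel.indexOne I j a),
        ∃ hz : KBorel.mulE I (MvPolynomial.monomial (u - Finsupp.single m 1) 1) {m} ∈
            KBorel.cycles I j 1,
          (b ⟨(u, m), hp⟩ : KBorel.Homology I j 1) = KBorel.cls I j 1 ⟨_, hz⟩) := by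
  constructor
  · intro i hi
    obtain ⟨b, hb⟩ := hI.exists_basis ha j (zero_lt_one.trans hi)
    -- For i > 1 the set F is nonempty, and j ≤ f < m for any f ∈ F.
    have hset : {p ∈ KBorel.index I j i a | j ≤ p.2.2} = KBorel.index I j i a := by
      refine Set.sep_eq_self_iff_mem_true.2 fun p hp => ?_
      obtain ⟨-, -, hc, hj, hF, -⟩ := hp
      obtain ⟨f, hf⟩ := Finset.card_pos.1 (show 0 < p.2.1.card by omega)
      exact (hj f hf).trans (hF f hf).le
    refine ⟨b.reindex (Equiv.setCongr hset), fun u F m hp => ?_⟩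
    obtain ⟨hz, h⟩ := hb ⟨(u, F, m), hset.symm.subset hp⟩
    rw [KBorel.mulEWedge_eq_mulE I _ hp.2.2.2.2.1]
    refine ⟨hz, ?_⟩
    rw [Module.Basis.reindex_apply]
    exact h
  · obtain ⟨b, hb⟩ := hI.exists_basis ha j zero_lt_one
    -- For i = 1 the set F is empty, so j ≤ m is a genuine condition and the triples reduce to the
    -- pairs of (b).
    have hF : ∀ p ∈ KBorel.index I j 1 a, p.2.1 = ∅ := fun p hp =>
      Finset.card_eq_zero.1 (by have := hp.2.2.1; omega)
    have hmem : ∀ p : (Fin n →₀ ℕ) × Fin n, p ∈ KBorel.indexOne I j a →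
        (p.1, ∅, p.2) ∈ {p ∈ KBorel.index I j 1 a | j ≤ p.2.2} := fun p hp =>
      ⟨⟨hp.1, hp.2.1, rfl, by simp, by simp, by simp [KBorel.expo, hp.2.2.2]⟩, hp.2.2.1⟩
    let e : {p ∈ KBorel.index I j 1 a | j ≤ p.2.2} ≃ KBorel.indexOne I j a :=
      { toFun := fun p => ⟨(p.1.1, p.1.2.2), p.2.1.1, p.2.1.2.1, p.2.2, by
          have := p.2.1.2.2.2.2.2
          rwa [hF _ p.2.1, KBorel.expo, Finset.sum_empty, zero_add] at this⟩
        invFun := fun p => ⟨(p.1.1, ∅, p.1.2), hmem p p.2⟩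
        left_inv := fun p => Subtype.ext (Prod.ext rfl (Prod.ext (hF _ p.2.1).symm rfl))
        right_inv := fun p => rfl }
    refine ⟨b.reindex e, fun u m hp => ?_⟩
    obtain ⟨hz, h⟩ := hb ⟨(u, ∅, m), hmem _ hp⟩
    refine ⟨hz, ?_⟩
    rw [Module.Basis.reindex_apply]
    exact h
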